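/- A loop is a set $L$ with a binary operation $\cdot$ and a two-sided identity element $1$ such that for all $a,b\in L$ the equations $a\cdot x=b$ and $y\cdot a=b$ have unique solutions $x,y\in L$. The multiplication group of $L$ is the group of permutations of $L$ generated by all left translations $x\mapsto a\cdot x$ and right translations $x\mapsto x\cdot a$ ($a\in L$), and an inner mapping of $L$ is an element of this group that fixes $1$. The loop $L$ is automorphic if each of its inner mappings is an automorphism of $L$. Let $(Q,*)$ and $(Q',\cdot)$ be finite automorphic loops of odd order, and let $f:Q\to Q'$ be a half-isomorphism, that is, a bijection such that $f(x*y)\in\{f(x)\cdot f(y),\,f(y)\cdot f(x)\}$ for all $x,y\in Q$. Then $f$ is trivial: either $f$ is an isomorphism (i.e. $f(x*y)=f(x)\cdot f(y)$ for all $x,y\in Q$) or $f$ is an anti-isomorphism (i.e. $f(x*y)=f(y)\cdot f(x)$ for all $x,y\in Q$). -/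

import Mathlib

/-- A loop: a set with a binary operation having a two-sided identity element, in which the
equations `a * x = b` and `y * a = b` have unique solutions. -/
class IsLoop (L : Type*) [MulOneClass L] : Prop where
  existsUnique_mul_left : ∀ a b : L, ∃! x : L, a * x = b
  existsUnique_mul_right : ∀ a b : L, ∃! y : L, y * a = b

namespace IsLoop

section Translations

variable {L : Type*} [MulOneClass L] [IsLoop L]

theorem bijective_mul_left (a : L) : Function.Bijective fun x : L => a * x :=
  Function.bijective_iff_existsUnique _ |>.mpr fun b => existsUnique_mul_left a b

theorem bijective_mul_right (a : L) : Function.Bijective fun x : L => x * a :=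
  Function.bijective_iff_existsUnique _ |>.mpr fun b => existsUnique_mul_right a b

/-- The left translation `x ↦ a * x`, as a permutation of the loop. -/
noncomputable def leftTranslation (a : L) : Equiv.Perm L :=
  Equiv.ofBijective (fun x => a * x) (bijective_mul_left a)

/-- The right translation `x ↦ x * a`, as a permutation of the loop. -/
noncomputable def rightTranslation (a : L) : Equiv.Perm L :=
  Equiv.ofBijective (fun x => x * a) (bijective_mul_right a)

end Translations

variable (L : Type*) [MulOneClass L] [IsLoop L]

/-- The multiplication group of a loop, generated by all left and right translations. -/
def multiplicationGroup : Subgroup (Equiv.Perm L) :=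
  Subgroup.closure
    (Set.range (leftTranslation : L → Equiv.Perm L) ∪
      Set.range (rightTranslation : L → Equiv.Perm L))

/-- The inner mapping group: the elements of the multiplication group that fix the identity. -/
def innerMappingGroup : Subgroup (Equiv.Perm L) :=
  multiplicationGroup L ⊓ MulAction.stabilizer (Equiv.Perm L) (1 : L)

/-- An automorphic loop: every inner mapping is an automorphism. (Inner mappings are bijections
by construction, so being an automorphism means respecting the product.) -/
def IsAutomorphic : Prop :=
  ∀ φ ∈ innerMappingGroup L, ∀ x y : L, φ (x * y) = φ x * φ y

end IsLoop

/-- A half-isomorphism: a bijection `f` such that `f (x * y)` is always one of `f x * f y` and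
`f y * f x`. -/
def IsHalfIsomorphism {L L' : Type*} [Mul L] [Mul L'] (f : L → L') : Prop :=
  Function.Bijective f ∧ ∀ x y : L, f (x * y) = f x * f y ∨ f (x * y) = f y * f x

/-- An isomorphism: a bijection that respects the product. -/
def IsMulIsomorphism {L L' : Type*} [Mul L] [Mul L'] (f : L → L') : Prop :=
  Function.Bijective f ∧ ∀ x y : L, f (x * y) = f x * f y

/-- An anti-isomorphism: a bijection that reverses the product. -/
def IsMulAntiIsomorphism {L L' : Type*} [Mul L] [Mul L'] (f : L → L') : Prop :=
  Function.Bijective f ∧ ∀ x y : L, f (x * y) = f y * f x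

/-! Write `T_x` for `middleMapping x` and `P_x` for `quadraticMapping x`. Inner mappings commute
with inversion, so conjugation by inversion yields the antiautomorphic inverse property and `P_{α 1}
= α (α^J)⁻¹` for every `α` in the multiplication group; hence the twisted law
`quadraticMapping_pow_apply`. Odd order excludes involutions, which makes each `P_x` of odd order
and shows that `T_x² y = y` forces `x` and `y` to commute (`mul_comm_of_middleMapping_sq`).

A half-isomorphism respects `P`, hence preserves commuting. If `f` preserves `x * y` but reverses `x
* z`, neither pair commuting, then evaluating `T_{f x}` on `f (y * z)` in two ways leaves two
alternatives. Replacing `y`, `z` by their inverses makes these contradict each other. So each `x`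
has one sign, and an argument in the style of "no group is a union of two proper subgroups" makes
the sign global. -/

namespace IsLoop

section Basic

variable {L : Type*} [MulOneClass L] [IsLoop L]

@[simp] theorem leftTranslation_apply (a x : L) : leftTranslation a x = a * x := rfl

@[simp] theorem rightTranslation_apply (a x : L) : rightTranslation a x = x * a := rfl

theorem mul_left_cancel' {a x y : L} (h : a * x = a * y) : x = y :=
  (bijective_mul_left a).injective h

theorem mul_right_cancel' {a x y : L} (h : x * a = y * a) : x = y :=
  (bijective_mul_right a).injective h

theorem mul_leftTranslation_inv (a x : L) : a * (leftTranslation a)⁻¹ x = x :=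
  Equiv.apply_symm_apply (leftTranslation a) x

theorem rightTranslation_inv_mul (a x : L) : (rightTranslation a)⁻¹ x * a = x :=
  Equiv.apply_symm_apply (rightTranslation a) x

theorem leftTranslation_inv_eq_iff {a x y : L} : (leftTranslation a)⁻¹ x = y ↔ x = a * y :=
  Equiv.symm_apply_eq (leftTranslation a)

theorem rightTranslation_inv_eq_iff {a x y : L} : (rightTranslation a)⁻¹ x = y ↔ x = y * a :=
  Equiv.symm_apply_eq (rightTranslation a)

theorem leftTranslation_mem (a : L) : leftTranslation a ∈ multiplicationGroup L :=
  Subgroup.subset_closure (Or.inl ⟨a, rfl⟩)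

theorem rightTranslation_mem (a : L) : rightTranslation a ∈ multiplicationGroup L :=
  Subgroup.subset_closure (Or.inr ⟨a, rfl⟩)

theorem leftTranslation_one : leftTranslation (1 : L) = 1 := by ext; simp

theorem rightTranslation_one : rightTranslation (1 : L) = 1 := by ext; simp

/-- The middle inner mapping `x ↦ a \ (x * a)`. -/
noncomputable def middleMapping (a : L) : Equiv.Perm L :=
  (leftTranslation a)⁻¹ * rightTranslation a

theorem mul_middleMapping (a x : L) : a * middleMapping a x = x * a :=
  mul_leftTranslation_inv a (x * a)

theorem middleMapping_eq_iff {a x y : L} : middleMapping a x = y ↔ x * a = a * y :=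
  leftTranslation_inv_eq_iff

theorem middleMapping_mem (a : L) : middleMapping a ∈ multiplicationGroup L :=
  mul_mem (inv_mem (leftTranslation_mem a)) (rightTranslation_mem a)

theorem middleMapping_apply_one (a : L) : middleMapping a 1 = 1 :=
  middleMapping_eq_iff.2 (by simp)

theorem middleMapping_eq_self_iff {a x : L} : middleMapping a x = x ↔ x * a = a * x :=
  middleMapping_eq_iff

/-- The right inverse of an element of a loop. -/
noncomputable def inverse (a : L) : L := (leftTranslation a)⁻¹ 1

theorem mul_inverse (a : L) : a * inverse a = 1 := mul_leftTranslation_inv a 1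

theorem inverse_eq_of_mul_eq_one {a b : L} (h : a * b = 1) : inverse a = b :=
  mul_left_cancel' (a := a) (by rw [mul_inverse, h])

theorem inverse_one : inverse (1 : L) = 1 := inverse_eq_of_mul_eq_one (one_mul 1)

end Basic

/-! ### Identities from inner mappings, up to the antiautomorphic inverse property -/

namespace IsAutomorphic

variable {L : Type*} [MulOneClass L] [IsLoop L]

theorem map_mul (h : IsAutomorphic L) {φ : Equiv.Perm L} (hφ : φ ∈ multiplicationGroup L)
    (h1 : φ 1 = 1) (x y : L) : φ (x * y) = φ x * φ y :=
  h φ ⟨hφ, h1⟩ x y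

theorem map_inverse (h : IsAutomorphic L) {φ : Equiv.Perm L} (hφ : φ ∈ multiplicationGroup L)
    (h1 : φ 1 = 1) (x : L) : φ (inverse x) = inverse (φ x) :=
  (inverse_eq_of_mul_eq_one (by rw [← h.map_mul hφ h1, mul_inverse, h1])).symm

theorem middleMapping_mul (h : IsAutomorphic L) (a x y : L) :
    middleMapping a (x * y) = middleMapping a x * middleMapping a y :=
  h.map_mul (middleMapping_mem a) (middleMapping_apply_one a) x y

theorem middleMapping_inverse (h : IsAutomorphic L) (a x : L) :
    middleMapping a (inverse x) = inverse (middleMapping a x) :=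
  h.map_inverse (middleMapping_mem a) (middleMapping_apply_one a) x

theorem mul_comm_mul (h : IsAutomorphic L) {a x y : L} (hx : x * a = a * x) (hy : y * a = a * y) :
    x * y * a = a * (x * y) := by
  rw [← middleMapping_eq_self_iff] at *
  rw [h.middleMapping_mul, hx, hy]

theorem mul_comm_of_mul_comm_mul (h : IsAutomorphic L) {a x y : L}
    (hxy : x * y * a = a * (x * y)) (hy : y * a = a * y) : x * a = a * x := by
  rw [← middleMapping_eq_self_iff] at *
  rw [h.middleMapping_mul, hy] at hxy
  exact mul_right_cancel' hxy

theorem flexible (h : IsAutomorphic L) (x y : L) : x * (y * x) = (x * y) * x := by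
  rw [← mul_middleMapping x (x * y), h.middleMapping_mul, middleMapping_eq_self_iff.2 rfl,
    mul_middleMapping]

theorem inverse_mul (h : IsAutomorphic L) (x : L) : inverse x * x = 1 := by
  apply mul_left_cancel' (a := x)
  rw [h.flexible, mul_inverse, one_mul, mul_one]

theorem inverse_inverse (h : IsAutomorphic L) (x : L) : inverse (inverse x) = x :=
  inverse_eq_of_mul_eq_one (h.inverse_mul x)

theorem mul_inverse_comm (h : IsAutomorphic L) {a x : L} (hx : x * a = a * x) :
    inverse x * a = a * inverse x := by
  rw [← middleMapping_eq_self_iff] at *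
  rw [h.middleMapping_inverse, hx]

theorem mul_mul_inverse (h : IsAutomorphic L) (x y : L) :
    x * (y * inverse x) = (x * y) * inverse x := by
  have := h.map_mul (φ := leftTranslation x * rightTranslation (inverse x))
    (mul_mem (leftTranslation_mem _) (rightTranslation_mem _))
    (by simp [mul_inverse]) x y
  simp only [Equiv.Perm.mul_apply, leftTranslation_apply, rightTranslation_apply, mul_inverse,
    mul_one] at this
  exact (mul_left_cancel' this).symm

theorem inverse_mul_mul_self (h : IsAutomorphic L) (x : L) : inverse x * (x * x) = x := by
  have h1 : x * inverse x = inverse x * x := by rw [mul_inverse, h.inverse_mul]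
  rw [← h.mul_comm_mul h1 h1, ← h.mul_mul_inverse, mul_inverse, mul_one]

theorem inverse_mul_mul (h : IsAutomorphic L) (x y : L) :
    inverse x * (x * y) = x * (inverse x * y) := by
  have key := h.map_mul (φ := leftTranslation (inverse x) * leftTranslation x)
    (mul_mem (leftTranslation_mem _) (leftTranslation_mem _))
    (by simp [h.inverse_mul]) x ((leftTranslation x)⁻¹ y)
  simpa only [Equiv.Perm.mul_apply, leftTranslation_apply, mul_leftTranslation_inv,
    h.inverse_mul_mul_self] using key

/-- The left inner mapping `w ↦ (x * y) \ (x * (y * w))`. -/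
theorem exists_leftInnerMapping (x y : L) : ∃ φ ∈ multiplicationGroup L, φ 1 = 1 ∧
    ∀ w, x * y * φ w = x * (y * w) :=
  ⟨(leftTranslation (x * y))⁻¹ * (leftTranslation x * leftTranslation y),
    mul_mem (inv_mem (leftTranslation_mem _))
      (mul_mem (leftTranslation_mem _) (leftTranslation_mem _)),
    leftTranslation_inv_eq_iff.2 (by simp), fun w => mul_leftTranslation_inv _ _⟩

/-- The antiautomorphic inverse property. -/
theorem inverse_mul_rev (h : IsAutomorphic L) (x y : L) :
    inverse (x * y) = inverse y * inverse x := by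
  obtain ⟨φ, hφ, hφ1, hφw⟩ := exists_leftInnerMapping x y
  obtain ⟨z, hz⟩ : ∃ z, z = x * y := ⟨_, rfl⟩
  obtain ⟨v, hv⟩ : ∃ v, v = φ (inverse y) := ⟨_, rfl⟩
  obtain ⟨u, hu⟩ := φ.surjective z
  have hzv : z * v = x := by rw [hz, hv, hφw, mul_inverse, mul_one]
  -- With `z = x * y`, this is what makes the inner mapping `κ = L_{y⁻¹} L_x⁻¹ L_z` fix `z`. It then
  -- fixes `z⁻¹` too, and `κ z⁻¹` is `y⁻¹ * x⁻¹`.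
  have key : y * (inverse y * u) = z := by
    apply mul_left_cancel' (a := x)
    rw [← hφw, h.map_mul hφ hφ1, ← hv, hu, ← hz, h.flexible, hzv]
  have hκ1 : (leftTranslation x)⁻¹ z = y := leftTranslation_inv_eq_iff.2 hz
  have hκz : (leftTranslation x)⁻¹ (z * z) = y * u := by
    rw [leftTranslation_inv_eq_iff, ← hφw, hu, hz]
  have hκ := h.map_inverse
    (φ := leftTranslation (inverse y) * ((leftTranslation x)⁻¹ * leftTranslation z))
    (mul_mem (leftTranslation_mem _) (mul_mem (inv_mem (leftTranslation_mem _))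
      (leftTranslation_mem _)))
    (by simp only [Equiv.Perm.mul_apply, leftTranslation_apply, mul_one, hκ1, h.inverse_mul]) z
  simp only [Equiv.Perm.mul_apply, leftTranslation_apply, mul_inverse, hκz] at hκ
  rw [h.inverse_mul_mul, key] at hκ
  rw [← hz, ← hκ]
  rfl

end IsAutomorphic

end IsLoop

/-! ### Quadratic mappings and conjugation by inversion -/

namespace IsLoop

/-- The permutation `x ↦ (a * ·) ∘ (· * a⁻¹)⁻¹`, which in a group is `x ↦ a * x * a`. -/
noncomputable def quadraticMapping {L : Type*} [MulOneClass L] [IsLoop L] (a : L) :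
    Equiv.Perm L :=
  leftTranslation a * (rightTranslation (inverse a))⁻¹

namespace IsAutomorphic

variable {L : Type*} [MulOneClass L] [IsLoop L]

/-- The inversion of an automorphic loop, as a permutation. -/
noncomputable def inversion (h : IsAutomorphic L) : Equiv.Perm L :=
  Function.Involutive.toPerm inverse h.inverse_inverse

theorem inversion_apply (h : IsAutomorphic L) (x : L) : h.inversion x = inverse x := rfl

theorem inversion_mul_self (h : IsAutomorphic L) : h.inversion * h.inversion = 1 := by
  ext x
  exact h.inverse_inverse x

theorem inversion_inv (h : IsAutomorphic L) : h.inversion⁻¹ = h.inversion :=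
  inv_eq_of_mul_eq_one_left h.inversion_mul_self

theorem conj_leftTranslation (h : IsAutomorphic L) (x : L) :
    MulAut.conj h.inversion (leftTranslation x) = rightTranslation (inverse x) := by
  ext y
  simp [inversion_apply, h.inversion_inv, h.inverse_mul_rev, h.inverse_inverse]

theorem conj_rightTranslation (h : IsAutomorphic L) (x : L) :
    MulAut.conj h.inversion (rightTranslation x) = leftTranslation (inverse x) := by
  ext y
  simp [inversion_apply, h.inversion_inv, h.inverse_mul_rev, h.inverse_inverse]

theorem conj_quadraticMapping (h : IsAutomorphic L) (x : L) :
    MulAut.conj h.inversion (quadraticMapping x) = (quadraticMapping x)⁻¹ := by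
  rw [quadraticMapping, _root_.map_mul, _root_.map_inv, h.conj_leftTranslation,
    h.conj_rightTranslation, h.inverse_inverse, mul_inv_rev, inv_inv]

theorem conj_eq_self (h : IsAutomorphic L) {φ : Equiv.Perm L} (hφ : φ ∈ multiplicationGroup L)
    (h1 : φ 1 = 1) : MulAut.conj h.inversion φ = φ := by
  rw [MulAut.conj_apply, mul_inv_eq_iff_eq_mul]
  ext x
  exact (h.map_inverse hφ h1 x).symm

/-- `L_{α 1}⁻¹ α` is inner, so conjugation by inversion fixes it, while turning `L_{α 1}` into
`R_{(α 1)⁻¹}`. Different `α` with the same value at `1` give different factorizations of one `P`. -/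
theorem quadraticMapping_apply_one_of_mem (h : IsAutomorphic L) {α : Equiv.Perm L}
    (hα : α ∈ multiplicationGroup L) :
    quadraticMapping (α 1) = α * (MulAut.conj h.inversion α)⁻¹ := by
  have := h.conj_eq_self (φ := (leftTranslation (α 1))⁻¹ * α)
    (mul_mem (inv_mem (leftTranslation_mem _)) hα)
    (leftTranslation_inv_eq_iff.2 (mul_one _).symm)
  rw [_root_.map_mul, _root_.map_inv, h.conj_leftTranslation, inv_mul_eq_iff_eq_mul] at this
  rw [this, quadraticMapping]
  group

theorem quadraticMapping_mem (x : L) : quadraticMapping x ∈ multiplicationGroup L :=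
  mul_mem (leftTranslation_mem _) (inv_mem (rightTranslation_mem _))

theorem quadraticMapping_eq (h : IsAutomorphic L) (x : L) :
    quadraticMapping x = rightTranslation x * (leftTranslation (inverse x))⁻¹ := by
  have := h.quadraticMapping_apply_one_of_mem (rightTranslation_mem x)
  rwa [h.conj_rightTranslation, rightTranslation_apply, one_mul] at this

theorem quadraticMapping_one : quadraticMapping (1 : L) = 1 := by
  rw [quadraticMapping, inverse_one, leftTranslation_one, rightTranslation_one, inv_one, one_mul]

theorem quadraticMapping_mul_inverse (x y : L) : quadraticMapping x (y * inverse x) = x * y :=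
  congrArg (x * ·) (rightTranslation_inv_eq_iff.2 rfl)

theorem quadraticMapping_inverse_mul (h : IsAutomorphic L) (x y : L) :
    quadraticMapping x (inverse x * y) = y * x := by
  rw [h.quadraticMapping_eq]
  exact congrArg (· * x) (leftTranslation_inv_eq_iff.2 rfl)

theorem quadraticMapping_mul_inverse' (h : IsAutomorphic L) (x y : L) :
    quadraticMapping x y * inverse x = x * y := by
  have : quadraticMapping x y * inverse x =
      x * ((rightTranslation (inverse x))⁻¹ y * inverse x) := (h.mul_mul_inverse _ _).symm
  rw [this, rightTranslation_inv_mul]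

theorem quadraticMapping_apply_one (x : L) :
    quadraticMapping x 1 = x * x := by
  rw [← quadraticMapping_mul_inverse, mul_inverse]

theorem middleMapping_inverse_left (h : IsAutomorphic L) (x : L) :
    middleMapping (inverse x) = (middleMapping x)⁻¹ := by
  have := h.quadraticMapping_eq x
  rw [quadraticMapping, mul_inv_eq_iff_eq_mul] at this
  rw [middleMapping, middleMapping, mul_inv_rev, inv_inv, this]
  group

theorem inverse_mul_quadraticMapping (h : IsAutomorphic L) (x y : L) :
    inverse x * quadraticMapping x y = y * x := by
  have := h.mul_mul_inverse (inverse x) ((leftTranslation (inverse x))⁻¹ y)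
  rw [h.inverse_inverse, mul_leftTranslation_inv] at this
  rw [h.quadraticMapping_eq, ← this]
  rfl

theorem quadraticMapping_mul (h : IsAutomorphic L) (x y : L) :
    quadraticMapping (x * y) =
      leftTranslation x * quadraticMapping y * (rightTranslation (inverse x))⁻¹ := by
  have := h.quadraticMapping_apply_one_of_mem
    (mul_mem (leftTranslation_mem x) (leftTranslation_mem y))
  rw [_root_.map_mul, h.conj_leftTranslation, h.conj_leftTranslation] at this
  simp only [Equiv.Perm.mul_apply, leftTranslation_apply, mul_one] at this
  rw [this, quadraticMapping]
  group

theorem quadraticMapping_mul' (h : IsAutomorphic L) (x y : L) :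
    quadraticMapping (x * y) =
      rightTranslation y * quadraticMapping x * (leftTranslation (inverse y))⁻¹ := by
  have := h.quadraticMapping_apply_one_of_mem
    (mul_mem (rightTranslation_mem y) (leftTranslation_mem x))
  rw [_root_.map_mul, h.conj_leftTranslation, h.conj_rightTranslation] at this
  simp only [Equiv.Perm.mul_apply, leftTranslation_apply, rightTranslation_apply, mul_one] at this
  rw [this, quadraticMapping]
  group

theorem quadraticMapping_mul_self (h : IsAutomorphic L) (x y : L) :
    quadraticMapping x y * y = x * y * (x * y) := by
  rw [← quadraticMapping_apply_one, h.quadraticMapping_mul']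
  simp only [Equiv.Perm.mul_apply, rightTranslation_apply]
  rw [leftTranslation_inv_eq_iff.2 (h.inverse_mul y).symm]

theorem mul_quadraticMapping_self (h : IsAutomorphic L) (x y : L) :
    y * quadraticMapping x y = y * x * (y * x) := by
  rw [← quadraticMapping_apply_one, h.quadraticMapping_mul]
  simp only [Equiv.Perm.mul_apply, leftTranslation_apply]
  rw [rightTranslation_inv_eq_iff.2 (mul_inverse y).symm]

theorem quadraticMapping_apply_of_mem (h : IsAutomorphic L) {α : Equiv.Perm L}
    (hα : α ∈ multiplicationGroup L) (x : L) :
    quadraticMapping (α x) = α * quadraticMapping x * (MulAut.conj h.inversion α)⁻¹ := by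
  have := h.quadraticMapping_apply_one_of_mem (mul_mem hα (leftTranslation_mem x))
  rw [_root_.map_mul, h.conj_leftTranslation] at this
  simp only [Equiv.Perm.mul_apply, leftTranslation_apply, mul_one] at this
  rw [this, quadraticMapping]
  group

/-- Conjugation by inversion inverts `P_x`, so the right-hand factor becomes `P_x ^ n` again. -/
theorem quadraticMapping_pow_apply (h : IsAutomorphic L) (x y : L) (n : ℕ) :
    quadraticMapping ((quadraticMapping x ^ n) y) =
      quadraticMapping x ^ n * quadraticMapping y * quadraticMapping x ^ n := by
  rw [h.quadraticMapping_apply_of_mem (pow_mem (quadraticMapping_mem x) n), _root_.map_pow,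
    h.conj_quadraticMapping, inv_pow, inv_inv]

end IsAutomorphic

end IsLoop

/-! ### Consequences of odd order -/

theorem Finset.card_mod_two_eq_card_filter_fixed {α : Type*} [DecidableEq α] (s : Finset α)
    (g : α → α) (hs : ∀ a ∈ s, g a ∈ s) (hg : ∀ a ∈ s, g (g a) = a) :
    Even s.card ↔ Even (s.filter fun a => g a = a).card := by
  have h0 : ∑ a ∈ s.filter (fun a => ¬ g a = a), (1 : ZMod 2) = 0 := by
    refine Finset.sum_involution (fun a _ => g a) (fun _ _ => by decide) ?_ ?_ ?_
    · intro a ha _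
      exact (Finset.mem_filter.1 ha).2
    · intro a ha
      obtain ⟨ha, hn⟩ := Finset.mem_filter.1 ha
      refine Finset.mem_filter.2 ⟨hs a ha, fun h => hn ?_⟩
      rw [hg a ha] at h
      exact h.symm
    · intro a ha
      exact hg a (Finset.mem_filter.1 ha).1
  rw [Finset.sum_const, nsmul_eq_mul, mul_one, ZMod.natCast_eq_zero_iff_even] at h0
  rw [← Finset.card_filter_add_card_filter_not (s := s) (fun a => g a = a), Nat.even_add]
  simp [h0]

namespace IsLoop

namespace IsAutomorphic

variable {L : Type*} [MulOneClass L] [IsLoop L]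

theorem middleMapping_sq_of_mul_self_eq_one (h : IsAutomorphic L) {c : L} (hc : c * c = 1) (x : L) :
    middleMapping c (middleMapping c x) = x := by
  have := h.middleMapping_inverse_left c
  rw [inverse_eq_of_mul_eq_one hc, eq_inv_iff_mul_eq_one] at this
  exact DFunLike.congr_fun this x

open Classical in
-- Parity counting replaces Lagrange's theorem. Take a maximal set `E` of commuting elements of
-- square `1` containing `c`, with odd centralizer. Inversion on the centralizer fixes exactly `E`,
-- so `E` is odd; but `a ↦ a \ c` is an involution of `E`, without fixed points if `c ≠ 1`.
theorem eq_one_of_mul_self_eq_one (h : IsAutomorphic L) (hodd : Odd (Nat.card L)) {c : L}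
    (hc : c * c = 1) : c = 1 := by
  have : Finite L := Nat.finite_of_card_ne_zero (by rintro h0; simp [h0] at hodd)
  have := Fintype.ofFinite L
  let C : Finset L → Finset L := fun E => Finset.univ.filter fun x => ∀ e ∈ E, x * e = e * x
  have hC : ∀ {E x}, x ∈ C E ↔ ∀ e ∈ E, x * e = e * x := by simp [C]
  -- `T_a` is an involution of `C E` whose fixed points form `C (insert a E)`.
  have hCinsert : ∀ (E : Finset L) (a : L), a * a = 1 → a ∈ C E → ¬ Even (C E).card →
      ¬ Even (C (insert a E)).card := by
    intro E a ha haE hE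
    rw [Finset.card_mod_two_eq_card_filter_fixed (C E) (middleMapping a)
      _ fun x _ => h.middleMapping_sq_of_mul_self_eq_one ha x] at hE
    · convert hE using 3
      ext x
      simp only [Finset.mem_filter, hC, Finset.forall_mem_insert, middleMapping_eq_self_iff]
      tauto
    · intro x hx
      rw [hC] at hx haE ⊢
      intro e he
      have hx := hx e he
      have haE := haE e he
      rw [← middleMapping_eq_self_iff, middleMapping_eq_iff] at haE
      have := congrArg (middleMapping a) hx
      rwa [h.middleMapping_mul, h.middleMapping_mul, middleMapping_eq_self_iff.2 haE.symm] at this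
  let S : Set (Finset L) := {E | (∀ e ∈ E, e * e = 1) ∧ E ⊆ C E ∧ ¬ Even (C E).card ∧ c ∈ E}
  have hSc : ({c} : Finset L) ∈ S := by
    refine ⟨by simpa using hc, by simp [hC], ?_, by simp⟩
    apply hCinsert ∅ c hc (by simp [hC])
    have : C ∅ = Finset.univ := by ext; simp [hC]
    rw [this, Finset.card_univ, ← Nat.card_eq_fintype_card]
    exact Nat.not_even_iff_odd.2 hodd
  obtain ⟨E, hcE, ⟨hE1, hE2, hE3, -⟩, hmax⟩ := (Set.toFinite S).exists_le_maximal hSc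
  replace hcE : c ∈ E := by simpa using hcE
  have hE : ∀ {a}, a ∈ E ↔ a ∈ C E ∧ a * a = 1 := by
    refine fun {a} => ⟨fun ha => ⟨hE2 ha, hE1 a ha⟩, fun ⟨ha, ha1⟩ => ?_⟩
    refine hmax (y := insert a E) ⟨?_, ?_, hCinsert E a ha1 ha hE3, ?_⟩ ?_ (Finset.mem_insert_self a E)
    · simpa [ha1] using hE1
    · intro x hx
      rw [hC]
      intro e he
      rw [Finset.mem_insert] at hx he
      rcases hx with rfl | hx <;> rcases he with rfl | he
      · rfl
      · exact hC.1 ha _ he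
      · exact (hC.1 ha _ hx).symm
      · exact hC.1 (hE2 hx) _ he
    · exact Finset.mem_insert_of_mem hcE
    · exact Finset.subset_insert a E
  have hEcard : ¬ Even E.card := by
    rw [Finset.card_mod_two_eq_card_filter_fixed (C E) inverse
      _ fun x _ => h.inverse_inverse x] at hE3
    · convert hE3 using 3
      ext x
      rw [hE, Finset.mem_filter (s := C E)]
      refine and_congr_right fun _ => ⟨fun hx : x * x = 1 => inverse_eq_of_mul_eq_one hx, fun hx => ?_⟩
      nth_rewrite 2 [← hx]
      exact mul_inverse x
    · intro x hx
      rw [hC] at hx ⊢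
      exact fun e he => h.mul_inverse_comm (hx e he)
  by_contra hne
  have hself : ∀ a ∈ E, inverse a = a := fun a ha => inverse_eq_of_mul_eq_one (hE1 a ha)
  have hcomm : ∀ a ∈ E, ∀ b, a * b = c → b ∈ C E := by
    intro a ha b hb
    rw [hC]
    intro e he
    rw [← middleMapping_eq_self_iff]
    apply mul_left_cancel' (a := a)
    nth_rewrite 1 [← middleMapping_eq_self_iff.2 (hC.1 (hE2 ha) e he)]
    rw [← h.middleMapping_mul, hb, middleMapping_eq_self_iff]
    exact hC.1 (hE2 hcE) e he
  have hdiv : ∀ a, a * (leftTranslation a)⁻¹ c = c := fun a => mul_leftTranslation_inv a c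
  refine hEcard ((Finset.card_mod_two_eq_card_filter_fixed E (fun a => (leftTranslation a)⁻¹ c)
    ?_ ?_).2 ?_)
  · intro a ha
    have hb := hcomm a ha _ (hdiv a)
    refine hE.2 ⟨hb, ?_⟩
    have hab := hC.1 hb a ha
    have hinv := congrArg inverse (hdiv a)
    rw [h.inverse_mul_rev, hself a ha, hself c hcE] at hinv
    have := mul_right_cancel' (hinv.trans ((hdiv a).symm.trans hab.symm))
    nth_rewrite 2 [← this]
    exact mul_inverse _
  · intro a ha
    rw [leftTranslation_inv_eq_iff, hC.1 (hcomm a ha _ (hdiv a)) a ha]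
    exact (hdiv a).symm
  · rw [Finset.filter_false_of_mem, Finset.card_empty]
    · exact Even.zero
    · intro a ha hfix
      rw [leftTranslation_inv_eq_iff, hE1 a ha] at hfix
      exact hne hfix

/-- Let `n` be the least positive exponent with `P_x ^ n` fixing `1`. If `n = 2k`, then `P_x ^ k`
sends `1` to an element of square `1`, against minimality. If `n = 2k + 1`, then `c = P_x ^ k x` has
square `1`, so `P_x ^ n = P_c = P_1`. -/
theorem exists_quadraticMapping_pow_eq_one (h : IsAutomorphic L) (hodd : Odd (Nat.card L))
    (x : L) : ∃ k, quadraticMapping x ^ (2 * k + 1) = 1 := by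
  have : Finite L := Nat.finite_of_card_ne_zero (by rintro h0; simp [h0] at hodd)
  have hex : ∃ n, 0 < n ∧ (quadraticMapping x ^ n) 1 = 1 :=
    ⟨orderOf (quadraticMapping x), orderOf_pos _, by rw [pow_orderOf_eq_one]; rfl⟩
  classical
  obtain ⟨hpos, hn⟩ := Nat.find_spec hex
  rcases Nat.even_or_odd' (Nat.find hex) with ⟨k, hk | hk⟩
  · exfalso
    refine Nat.find_min hex (m := k) (by lia) ⟨by lia, ?_⟩
    refine h.eq_one_of_mul_self_eq_one hodd ?_
    rw [← quadraticMapping_apply_one, h.quadraticMapping_pow_apply, quadraticMapping_one, mul_one,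
      ← pow_add, ← two_mul, ← hk, hn]
  · refine ⟨k, ?_⟩
    have key : quadraticMapping ((quadraticMapping x ^ k) x) = quadraticMapping x ^ (2 * k + 1) := by
      rw [h.quadraticMapping_pow_apply, ← pow_succ, ← pow_add]
      congr 1
      lia
    rw [← key, h.eq_one_of_mul_self_eq_one hodd (c := (quadraticMapping x ^ k) x),
      quadraticMapping_one]
    rw [← quadraticMapping_apply_one, key, ← hk, hn]

theorem eq_one_of_middleMapping_eq_inverse (h : IsAutomorphic L) (hodd : Odd (Nat.card L))
    {x u : L} (hu : middleMapping x u = inverse u) : u = 1 := by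
  rw [middleMapping_eq_iff] at hu
  have hfix : quadraticMapping u x = x := by
    apply mul_right_cancel' (a := inverse u)
    rw [h.quadraticMapping_mul_inverse', hu]
  have hconj := h.quadraticMapping_pow_apply u x 1
  rw [pow_one, hfix] at hconj
  obtain ⟨k, hk⟩ := h.exists_quadraticMapping_pow_eq_one hodd x
  -- `P_u` fixes `x`, so `P_x = P_u P_x P_u`: conjugation by `P_x` inverts `P_u`. As `P_x` has odd
  -- order, `P_u` is its own inverse.
  have hsq : quadraticMapping u * quadraticMapping u = 1 := by
    generalize quadraticMapping u = p at *
    generalize quadraticMapping x = q at *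
    have h1 : q * p = p⁻¹ * q := by
      rw [eq_inv_mul_iff_mul_eq, ← mul_assoc]
      exact hconj.symm
    have h2 : q * p⁻¹ = p * q := by
      rw [mul_inv_eq_iff_eq_mul]
      exact hconj
    have h3 : ∀ n, q ^ (2 * n) * p = p * q ^ (2 * n) := by
      intro n
      refine (Commute.pow_left ?_ n |> fun hc => by rw [pow_mul]; exact hc : Commute (q ^ (2 * n)) p)
      show q ^ 2 * p = p * q ^ 2
      rw [pow_two, mul_assoc, h1, ← mul_assoc, h2, mul_assoc]
    have h4 : q ^ (2 * k + 1) * p = p⁻¹ * q ^ (2 * k + 1) := by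
      rw [pow_succ, mul_assoc, h1, ← mul_assoc, ← mul_assoc]
      congr 1
      rw [mul_inv_eq_iff_eq_mul, mul_assoc, h3, inv_mul_cancel_left]
    rw [hk, one_mul, mul_one] at h4
    nth_rewrite 1 [h4]
    exact inv_mul_cancel p
  have huu : u * u = 1 := by
    apply h.eq_one_of_mul_self_eq_one hodd
    have := h.quadraticMapping_pow_apply u 1 1
    rw [pow_one, quadraticMapping_one, mul_one, hsq, quadraticMapping_apply_one] at this
    rw [← quadraticMapping_apply_one, this]
    rfl
  exact h.eq_one_of_mul_self_eq_one hodd huu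

/-- `T_x` inverts `y⁻¹ * T_x y`, which is therefore `1`. -/
theorem mul_comm_of_middleMapping_sq (h : IsAutomorphic L) (hodd : Odd (Nat.card L))
    {x y : L} (hy : middleMapping x (middleMapping x y) = y) : y * x = x * y := by
  rw [← middleMapping_eq_self_iff]
  have := h.eq_one_of_middleMapping_eq_inverse hodd (x := x) (u := inverse y * middleMapping x y)
    (by rw [h.middleMapping_mul, h.middleMapping_inverse, hy, h.inverse_mul_rev, h.inverse_inverse])
  exact mul_left_cancel' (this.trans (h.inverse_mul y).symm)

end IsAutomorphic

end IsLoop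

open IsLoop IsLoop.IsAutomorphic

/-! ### Half-isomorphisms respect quadratic mappings and commuting -/

namespace IsHalfIsomorphism

variable {L M : Type*}

theorem map_mul_self [Mul L] [Mul M] {f : L → M} (hf : IsHalfIsomorphism f) (x : L) :
    f (x * x) = f x * f x := by
  have := hf.2 x x
  rwa [or_self] at this

theorem mul_comm_of_map [Mul L] [Mul M] {f : L → M} (hf : IsHalfIsomorphism f) {x y : L}
    (h : f x * f y = f y * f x) :
    x * y = y * x := by
  apply hf.1.injective
  have h1 := hf.2 x y
  have h2 := hf.2 y x
  rw [h, or_self] at h1 h2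
  rw [h1, h2]

theorem map_one [MulOneClass L] [MulOneClass M] [IsLoop M] {f : L → M}
    (hf : IsHalfIsomorphism f) : f 1 = 1 := by
  apply mul_left_cancel' (a := f 1)
  rw [mul_one]
  have := hf.2 1 1
  rw [mul_one, or_self] at this
  exact this.symm

variable [MulOneClass L] [IsLoop L] [MulOneClass M] [IsLoop M] {f : L → M}

theorem map_inverse (hf : IsHalfIsomorphism f) (hM : IsAutomorphic M) (x : L) :
    f (inverse x) = inverse (f x) := by
  have := hf.2 x (inverse x)
  rw [mul_inverse, hf.map_one] at this
  rcases this with this | this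
  · exact (inverse_eq_of_mul_eq_one this.symm).symm
  · rw [← inverse_eq_of_mul_eq_one this.symm, hM.inverse_inverse]

theorem map_quadraticMapping (hf : IsHalfIsomorphism f) (hL : IsAutomorphic L)
    (hM : IsAutomorphic M) (x y : L) :
    f (quadraticMapping x y) = quadraticMapping (f x) (f y) := by
  obtain ⟨w, hw⟩ : ∃ w, w = f (quadraticMapping x y) := ⟨_, rfl⟩
  obtain ⟨z, hz⟩ : ∃ z, z = quadraticMapping (f x) (f y) := ⟨_, rfl⟩
  have e1 := hf.2 (inverse x) (quadraticMapping x y)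
  have e2 := hf.2 y (quadraticMapping x y)
  have z1 := hM.quadraticMapping_mul_inverse' (f x) (f y)
  have z2 := hM.inverse_mul_quadraticMapping (f x) (f y)
  have z3 := hM.quadraticMapping_mul_self (f x) (f y)
  have z4 := hM.mul_quadraticMapping_self (f x) (f y)
  rw [hL.inverse_mul_quadraticMapping, hf.map_inverse hM, ← hw] at e1
  rw [hL.mul_quadraticMapping_self, hf.map_mul_self, ← hw] at e2
  rw [← hz] at z1 z2 z3 z4
  rw [← hw, ← hz]
  have T := hM.middleMapping_mul (f x)
  have Txy : middleMapping (f x) (f x * f y) = f y * f x := by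
    rw [T, middleMapping_eq_self_iff.2 rfl, mul_middleMapping]
  have Tzy : middleMapping (f x) (z * f y) = f y * z := by
    rw [z3, T, Txy, z4]
  have hcancel : ∀ {w z : M}, w * inverse (f x) = inverse (f x) * z →
      w = middleMapping (f x) z := by
    intro w z hwz
    rw [← middleMapping_eq_iff, hM.middleMapping_inverse_left, Equiv.Perm.inv_eq_iff_eq] at hwz
    exact hwz
  -- Each branch either cancels to `w = z` at once or forces `T_{f x}` to fix `f y`; then `f x` and
  -- `f y` commute and the distinction disappears.
  rcases hf.2 y x with h | h <;> rw [h] at e1 e2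
  · rcases e1 with e1 | e1
    · exact mul_left_cancel' (e1.symm.trans z2.symm)
    rcases e2 with e2 | e2
    · exact mul_left_cancel' (e2.symm.trans z4.symm)
    have hcomm : middleMapping (f x) (f y) = f y := by
      rw [T, ← hcancel (e1.symm.trans z2.symm), z4, e2] at Tzy
      exact mul_left_cancel' Tzy
    apply mul_right_cancel' (a := inverse (f x))
    rw [z1, ← e1, middleMapping_eq_self_iff.1 hcomm]
  · rcases e1 with e1 | e1
    swap
    · exact mul_right_cancel' (e1.symm.trans z1.symm)
    rcases e2 with e2 | e2
    swap
    · exact mul_right_cancel' (e2.symm.trans z3.symm)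
    have hcomm : middleMapping (f x) (f y) = f y := by
      rw [z3, e2, T, ← hcancel (z1.trans e1)] at Tzy
      exact mul_right_cancel' Tzy
    apply mul_left_cancel' (a := inverse (f x))
    rw [z2, ← e1, middleMapping_eq_self_iff.1 hcomm]

/-- `P_x` and `P_y` send `y⁻¹ * x⁻¹` to `x * y⁻¹` and `x⁻¹ * y`, the latter being inverse to `y⁻¹ *
x = x * y⁻¹`. Transporting both by `f` makes `f x` commute with `(f y)⁻¹`. -/
theorem map_mul_comm_of_map_mul (hf : IsHalfIsomorphism f) (hL : IsAutomorphic L)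
    (hM : IsAutomorphic M) {x y : L} (hxy : x * y = y * x) (h : f (x * y) = f x * f y) :
    f x * f y = f y * f x := by
  have hinv : f (inverse y * inverse x) = inverse (f y) * inverse (f x) := by
    rw [← hL.inverse_mul_rev, hf.map_inverse hM, h, hM.inverse_mul_rev]
  have h1 := hf.map_quadraticMapping hL hM x (inverse y * inverse x)
  have h2 := hf.map_quadraticMapping hL hM y (inverse y * inverse x)
  rw [hinv, quadraticMapping_mul_inverse, quadraticMapping_mul_inverse] at h1
  rw [hinv, hL.quadraticMapping_inverse_mul, hM.quadraticMapping_inverse_mul] at h2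
  have h3 := congrArg inverse h2
  rw [← hf.map_inverse hM, hL.inverse_mul_rev, hL.inverse_inverse, hM.inverse_mul_rev,
    hM.inverse_inverse, hL.mul_inverse_comm hxy.symm, h1] at h3
  have := hM.mul_inverse_comm h3.symm
  rw [hM.inverse_inverse] at this
  exact this.symm

theorem map_mul_comm (hf : IsHalfIsomorphism f) (hL : IsAutomorphic L) (hM : IsAutomorphic M)
    {x y : L} (hxy : x * y = y * x) : f x * f y = f y * f x := by
  rcases hf.2 x y with h | h
  · exact hf.map_mul_comm_of_map_mul hL hM hxy h
  · rw [hxy] at h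
    exact (hf.map_mul_comm_of_map_mul hL hM hxy.symm h).symm

end IsHalfIsomorphism

/-! ### Each element has a constant sign, and the sign is global -/

namespace IsHalfIsomorphism

variable {L M : Type*}

theorem map_mul_swap [Mul L] [Mul M] {f : L → M} (hf : IsHalfIsomorphism f) {x y : L}
    (hne : x * y ≠ y * x)
    (h : f (x * y) = f x * f y) : f (y * x) = f y * f x :=
  (hf.2 y x).resolve_right fun h' => hne (hf.1.injective (h.trans h'.symm))

theorem map_mul_swap' [Mul L] [Mul M] {f : L → M} (hf : IsHalfIsomorphism f) {x y : L}
    (hne : x * y ≠ y * x)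
    (h : f (x * y) = f y * f x) : f (y * x) = f x * f y :=
  (hf.2 y x).resolve_left fun h' => hne (hf.1.injective (h.trans h'.symm))

variable [MulOneClass L] [IsLoop L] [MulOneClass M] [IsLoop M] {f : L → M}

theorem map_mul_eq_or (hf : IsHalfIsomorphism f) (hL : IsAutomorphic L) (hM : IsAutomorphic M)
    (a b : L) : f a * f b = f (a * b) ∨ f a * f b = f (b * a) := by
  by_cases hab : a * b = b * a
  · rcases hf.2 a b with h | h
    · exact Or.inl h.symm
    · exact Or.inl ((hf.map_mul_comm hL hM hab).trans h.symm)
  · rcases hf.2 a b with h | h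
    · exact Or.inl h.symm
    · exact Or.inr (hf.map_mul_swap' hab h).symm

theorem middleMapping_map_of_map_mul (hf : IsHalfIsomorphism f) {x y : L} (hne : x * y ≠ y * x)
    (h : f (x * y) = f x * f y) : middleMapping (f x) (f y) = f (middleMapping x y) := by
  have h1 := hf.map_mul_swap hne h
  rw [middleMapping_eq_iff, ← h1, ← mul_middleMapping]
  refine (hf.2 _ _).resolve_right fun h2 => hne ?_
  rw [mul_middleMapping, h1] at h2
  rw [eq_comm, ← middleMapping_eq_self_iff]
  exact (hf.1.injective (mul_right_cancel' h2)).symm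

theorem middleMapping_map_middleMapping (hf : IsHalfIsomorphism f) {x y : L}
    (hne : x * y ≠ y * x) (h : f (x * y) = f y * f x) :
    middleMapping (f x) (f (middleMapping x y)) = f y := by
  have h1 := hf.map_mul_swap' hne h
  rw [middleMapping_eq_iff, ← h1, ← mul_middleMapping x y, eq_comm]
  refine (hf.2 _ _).resolve_left fun h2 => hne ?_
  rw [mul_middleMapping, h1] at h2
  rw [eq_comm, ← middleMapping_eq_self_iff]
  exact (hf.1.injective (mul_left_cancel' h2)).symm

theorem middleMapping_map_of_map_mul_rev (hf : IsHalfIsomorphism f) {x v : L}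
    (hne : x * v ≠ v * x)
    (h : f (x * middleMapping x v) = f (middleMapping x v) * f x) :
    middleMapping (f x) (f (middleMapping x v)) = f v := by
  rcases hf.2 x v with hv | hv
  · exfalso
    have h1 := hf.middleMapping_map_of_map_mul hne hv
    rw [mul_middleMapping, hf.map_mul_swap hne hv, ← h1] at h
    exact hne (hf.mul_comm_of_map (middleMapping_eq_self_iff.1 (mul_right_cancel' h).symm).symm)
  · exact hf.middleMapping_map_middleMapping hne hv

/-- `T_{f x} (f (y * z))` is the image of `T_x y` times `T_x w` in some order, and also of `T_x (y *
z)` or `T_x⁻¹ (y * z)`. Of the four combinations, two make `T_x²` fix `y` or `z`, which is excluded;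
the others are the stated alternatives. -/
theorem middleMapping_eq_or (hf : IsHalfIsomorphism f) (hL : IsAutomorphic L)
    (hM : IsAutomorphic M) (hodd : Odd (Nat.card L)) {x y z w : L} (hxy : y * x ≠ x * y)
    (hxz : z * x ≠ x * z) (hw : middleMapping x (middleMapping x w) = z)
    (hy : middleMapping (f x) (f y) = f (middleMapping x y))
    (hz : middleMapping (f x) (f z) = f (middleMapping x w)) :
    middleMapping z y = middleMapping x (middleMapping x y) ∨ middleMapping y w = z := by
  rw [middleMapping_eq_iff, middleMapping_eq_iff]
  have hT := hL.middleMapping_mul x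
  have h1 : middleMapping (f x) (f (y * z)) = f (middleMapping x y * middleMapping x w) ∨
      middleMapping (f x) (f (y * z)) = f (middleMapping x w * middleMapping x y) := by
    rcases hf.2 y z with h | h <;> rw [h, hM.middleMapping_mul, hy, hz]
    · exact hf.map_mul_eq_or hL hM _ _
    · exact (hf.map_mul_eq_or hL hM _ _).symm
  have h2 : middleMapping (f x) (f (y * z)) = f (middleMapping x (y * z)) ∨
      ∃ s, middleMapping x s = y * z ∧ middleMapping (f x) (f (y * z)) = f s := by
    by_cases hc : x * (y * z) = y * z * x
    · left
      rw [middleMapping_eq_self_iff.2 hc.symm, middleMapping_eq_self_iff]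
      exact (hf.map_mul_comm hL hM hc).symm
    rcases hf.2 x (y * z) with h | h
    · exact Or.inl (hf.middleMapping_map_of_map_mul hc h)
    · right
      obtain ⟨s, hs⟩ := (middleMapping x).surjective (y * z)
      refine ⟨s, hs, ?_⟩
      rw [← hs] at h hc ⊢
      refine hf.middleMapping_map_of_map_mul_rev (fun hsx => hc ?_) h
      rw [eq_comm, middleMapping_eq_self_iff.2 hsx.symm, hsx]
  rcases h2 with h2 | ⟨s, hs, h2⟩
  · rw [h2, hf.1.injective.eq_iff, hf.1.injective.eq_iff, hT] at h1
    rcases h1 with h1 | h1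
    · refine absurd (hL.mul_comm_of_middleMapping_sq hodd ?_) hxz
      have := (middleMapping x).injective (mul_left_cancel' h1)
      rw [← this] at hw
      exact hw
    · rw [← hT, ← hT, EmbeddingLike.apply_eq_iff_eq] at h1
      exact Or.inr h1.symm
  · rw [h2, hf.1.injective.eq_iff, hf.1.injective.eq_iff] at h1
    rcases h1 with h1 | h1 <;> rw [h1, hT, hw] at hs
    · exact absurd (hL.mul_comm_of_middleMapping_sq hodd (mul_right_cancel' hs)) hxy
    · exact Or.inl hs.symm

theorem not_middleMapping_map (hf : IsHalfIsomorphism f) (hL : IsAutomorphic L)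
    (hM : IsAutomorphic M) (hodd : Odd (Nat.card L)) {x y z w : L} (hxy : y * x ≠ x * y)
    (hxz : z * x ≠ x * z) (hw : middleMapping x (middleMapping x w) = z)
    (hy : middleMapping (f x) (f y) = f (middleMapping x y))
    (hz : middleMapping (f x) (f z) = f (middleMapping x w)) : False := by
  have hinv : ∀ {a : L}, a * x ≠ x * a → inverse a * x ≠ x * inverse a := by
    intro a ha h
    have := hL.mul_inverse_comm h
    rw [hL.inverse_inverse] at this
    exact ha this
  have hw' : middleMapping x (middleMapping x (inverse w)) = inverse z := by
    rw [hL.middleMapping_inverse, hL.middleMapping_inverse, hw]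
  have hy' : middleMapping (f x) (f (inverse y)) = f (middleMapping x (inverse y)) := by
    rw [hf.map_inverse hM, hM.middleMapping_inverse, hy, hL.middleMapping_inverse, hf.map_inverse hM]
  have hz' : middleMapping (f x) (f (inverse z)) = f (middleMapping x (inverse w)) := by
    rw [hf.map_inverse hM, hM.middleMapping_inverse, hz, hL.middleMapping_inverse, hf.map_inverse hM]
  -- Inverting `z` turns `T_z` into its inverse in the first alternative; inverting `y` does so for
  -- `T_y` in the second. Whichever alternatives hold, one of them holds with both signs, against
  -- `ha` or `hb`.
  have e1 := hf.middleMapping_eq_or hL hM hodd hxy hxz hw hy hz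
  have e2 := hf.middleMapping_eq_or hL hM hodd hxy (hinv hxz) hw' hy hz'
  have e3 := hf.middleMapping_eq_or hL hM hodd (hinv hxy) hxz hw hy' hz
  have e4 := hf.middleMapping_eq_or hL hM hodd (hinv hxy) (hinv hxz) hw' hy' hz'
  have hinj : Function.Injective (inverse : L → L) :=
    Function.LeftInverse.injective hL.inverse_inverse
  have hsymm : ∀ a b : L, (middleMapping a)⁻¹ (inverse b) = inverse ((middleMapping a)⁻¹ b) := by
    intro a b
    rw [← hL.middleMapping_inverse_left, hL.middleMapping_inverse]
  simp only [hL.middleMapping_inverse, hinj.eq_iff, hL.middleMapping_inverse_left, hsymm] at e1 e2 e3 e4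
  have ha : middleMapping z y = middleMapping x (middleMapping x y) →
      (middleMapping z)⁻¹ y = middleMapping x (middleMapping x y) → False := by
    intro h1 h2
    rw [← h1, Equiv.Perm.inv_eq_iff_eq] at h2
    have h3 := hL.mul_comm_of_middleMapping_sq hodd h2.symm
    rw [middleMapping_eq_self_iff.2 h3] at h1
    exact hxy (hL.mul_comm_of_middleMapping_sq hodd h1.symm)
  have hb : middleMapping y w = z → (middleMapping y)⁻¹ w = z → False := by
    intro h1 h2
    rw [← h1, Equiv.Perm.inv_eq_iff_eq] at h2
    have h3 := hL.mul_comm_of_middleMapping_sq hodd h2.symm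
    rw [middleMapping_eq_self_iff.2 h3] at h1
    rw [h1] at hw
    exact hxz (hL.mul_comm_of_middleMapping_sq hodd hw)
  rcases e1 with h1 | h1
  · rcases e2 with h2 | h2
    · exact ha h1 h2
    rcases e4 with h4 | h4
    · exact ha h1 h4
    · exact hb h2 h4
  · rcases e3 with h3 | h3
    · rcases e4 with h4 | h4
      · exact ha h3 h4
      · exact hb h1 h4
    · exact hb h1 h3

theorem forall_map_mul_or (hf : IsHalfIsomorphism f) (hL : IsAutomorphic L)
    (hM : IsAutomorphic M) (hodd : Odd (Nat.card L)) (x : L) :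
    (∀ y, f (x * y) = f x * f y) ∨ ∀ y, f (x * y) = f y * f x := by
  by_contra! hcon
  obtain ⟨⟨z, hz⟩, y, hy⟩ := hcon
  have hcomm : ∀ {a}, x * a = a * x → f (x * a) = f x * f a ∧ f (x * a) = f a * f x := by
    intro a ha
    have := hf.map_mul_comm hL hM ha
    have := hf.2 x a
    simp_all
  have hxy : x * y ≠ y * x := fun h => hy (hcomm h).2
  have hxz : x * z ≠ z * x := fun h => hz (hcomm h).1
  replace hy := (hf.2 x y).resolve_right hy
  replace hz := (hf.2 x z).resolve_left hz
  obtain ⟨v, rfl⟩ := (middleMapping x).surjective z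
  obtain ⟨w, rfl⟩ := (middleMapping x).surjective v
  refine hf.not_middleMapping_map hL hM hodd hxy.symm hxz.symm rfl
    (hf.middleMapping_map_of_map_mul hxy hy) (hf.middleMapping_map_of_map_mul_rev
      (fun h => hxz ?_) hz)
  rw [eq_comm, middleMapping_eq_self_iff.2 h.symm, h]

theorem isMulIsomorphism_or (hf : IsHalfIsomorphism f) (hL : IsAutomorphic L)
    (hM : IsAutomorphic M) (hodd : Odd (Nat.card L)) :
    IsMulIsomorphism f ∨ IsMulAntiIsomorphism f := by
  by_contra hcon
  simp only [IsMulIsomorphism, IsMulAntiIsomorphism, hf.1, true_and, not_or, not_forall] at hcon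
  obtain ⟨⟨a, b, hab⟩, c, d, hcd⟩ := hcon
  have hsign := hf.forall_map_mul_or hL hM hodd
  have ha := (hsign a).resolve_left fun h => hab (h b)
  have hc := (hsign c).resolve_right fun h => hcd (h d)
  have hne : ∀ {x y}, x * y = y * x → f (x * y) = f x * f y ∧ f (x * y) = f y * f x := by
    intro x y hxy
    have := hf.map_mul_comm hL hM hxy
    have := hf.2 x y
    simp_all
  have hba : b * a ≠ a * b := fun h => hab (hne h.symm).1
  have hdc : d * c ≠ c * d := fun h => hcd (hne h.symm).2
  -- Elements of opposite sign commute: `f` sends both of their products to the same element. Here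
  -- `a` reverses and `c` preserves, so `e` commutes with one of them.
  have key : ∀ e, e * a ≠ a * e → e * c ≠ c * e → False := by
    intro e hea hec
    rcases hsign e with h | h
    · exact hea (hf.1.injective ((h a).trans (ha e).symm))
    · exact hec (hf.1.injective ((h c).trans (hc e).symm))
  by_cases hbc : b * c = c * b
  swap
  · exact key b hba hbc
  by_cases hda : d * a = a * d
  swap
  · exact key d hda hdc
  -- `b` commutes with `c` but not `a`, and `d` with `a` but not `c`, so `b * d` commutes with
  -- neither.
  refine key (b * d) (fun h => hba (hL.mul_comm_of_mul_comm_mul h hda)) fun h => hdc ?_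
  rw [← middleMapping_eq_self_iff] at *
  rw [hL.middleMapping_mul, hbc] at h
  exact mul_left_cancel' h

end IsHalfIsomorphism

theorem corollary4p3 {Q : Type*} {Q' : Type*} [MulOneClass Q] [MulOneClass Q']
    [IsLoop Q] [IsLoop Q'] (hQ : IsLoop.IsAutomorphic Q) (hQ' : IsLoop.IsAutomorphic Q')
    (hodd : Odd (Nat.card Q)) (hodd' : Odd (Nat.card Q'))
    (f : Q → Q') (hf : IsHalfIsomorphism f) :
    IsMulIsomorphism f ∨ IsMulAntiIsomorphism f :=
  hf.isMulIsomorphism_or hQ hQ' hodd
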